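/- Let $\mathcal{C}$ be a category with all pullbacks, and let $(T,\eta,\mu)$ be a cartesian monad on $\mathcal{C}$: $T$ preserves pullbacks, and all naturality squares of $\eta$ and of $\mu$ are pullbacks. Let $\mathbf{Cat}(\mathcal{C})$ be the 2-category of categories internal to $\mathcal{C}$, internal functors and internal natural transformations. An internal category $X$ is a span $X_0 \xleftarrow{s} X_1 \xrightarrow{t} X_0$ with an identity $e \colon X_0 \to X_1$ and a composition $c \colon X_1\times_{X_0}X_1 \to X_1$ satisfying the category laws. Then there is a (strict) 2-monad $\mathbf{Cat}(T)$ on $\mathbf{Cat}(\mathcal{C})$, that is, a 2-functor with a 2-natural unit and multiplication satisfying the monad laws strictly, which lifts $T$ in the following sense. * It sends an internal category with underlying span $X_0 \xleftarrow{s} X_1 \xrightarrow{t} X_0$ to an internal category with underlying span $TX_0 \xleftarrow{Ts} TX_1 \xrightarrow{Tt} TX_0$, with identity $Te$, and whose composition becomes $Tc$ along the canonical isomorphism $T(X_1\times_{X_0}X_1)\cong TX_1\times_{TX_0}TX_1$. * It sends an internal functor $(F_0,F_1)$ to $(TF_0,TF_1)$, and an internal natural transformation with underlying morphism $\alpha \colon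 X_0\to Y_1$ to the one with underlying morphism $T\alpha$. * Its unit and multiplication at $X$ are the internal functors $(\eta_{X_0},\eta_{X_1})$ and $(\mu_{X_0},\mu_{X_1})$. As a corollary, every cartesian monad $T$ on $\mathbf{Set}$ lifts to a 2-monad, and in particular to a monad, $\widehat T$ on the 2-category $\mathbf{Cat}$ of small categories. For every small category $\mathcal{A}$, the set of objects of $\widehat T\mathcal{A}$ is $T(\mathrm{Ob}\,\mathcal{A})$, and the set of all arrows of $\widehat T\mathcal{A}$ is identified by a bijection with $T(\mathrm{Arr}\,\mathcal{A})$, where $\mathrm{Arr}\,\mathcal{A}$ is the set of all arrows of $\mathcal{A}$. Under these identifications, source, target, identities and composition of $\widehat T\mathcal{A}$, the action of $\widehat T$ on functors and on natural transformations, and the unit and multiplication of $\widehat T$ are obtained from those of $\mathcal{A}$ and of $T$ as above. -/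

import Mathlib

open CategoryTheory CategoryTheory.Limits

universe w v u

attribute [-instance] CategoryTheory.catToReflQuiver

/-! ### Cartesian monads -/

/-- A monad on a category with pullbacks is cartesian if its endofunctor preserves pullbacks and all
naturality squares of its unit and of its multiplication are pullbacks. -/
structure CategoryTheory.Monad.IsCartesian {C : Type u} [Category.{v} C] (T : Monad C) : Prop where
  preservesPullbacks : PreservesLimitsOfShape WalkingCospan T.toFunctor
  unit_cartesian : NatTrans.Equifibered T.η
  mul_cartesian : NatTrans.Equifibered T.μ

/-! ### The 2-category of internal categories -/

noncomputable section InternalCategories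

variable (C : Type u) [Category.{v} C] [HasPullbacks C]

/-- A category internal to a category `C` with pullbacks: a span `X₀ ← X₁ → X₀` (source and target)
with an identity `X₀ ⟶ X₁` and a composition `X₁ ×[X₀] X₁ ⟶ X₁`, which are morphisms of spans over
`X₀` and satisfy the unit and associativity laws. Composition is in diagrammatic order, and
associativity is stated on generalized elements. -/
structure InternalCat where
  X₀ : C
  X₁ : C
  src : X₁ ⟶ X₀
  tgt : X₁ ⟶ X₀
  ident : X₀ ⟶ X₁
  comp : pullback tgt src ⟶ X₁
  ident_src : ident ≫ src = 𝟙 X₀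
  ident_tgt : ident ≫ tgt = 𝟙 X₀
  comp_src : comp ≫ src = pullback.fst tgt src ≫ src
  comp_tgt : comp ≫ tgt = pullback.snd tgt src ≫ tgt
  ident_comp : pullback.lift (src ≫ ident) (𝟙 X₁)
    (by rw [Category.assoc, ident_tgt, Category.comp_id, Category.id_comp]) ≫ comp = 𝟙 X₁
  comp_ident : pullback.lift (𝟙 X₁) (tgt ≫ ident)
    (by rw [Category.assoc, ident_src, Category.comp_id, Category.id_comp]) ≫ comp = 𝟙 X₁
  assoc : ∀ {A : C} (f g h : A ⟶ X₁) (hfg : f ≫ tgt = g ≫ src) (hgh : g ≫ tgt = h ≫ src),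
    pullback.lift (pullback.lift f g hfg ≫ comp) h
      (by rw [Category.assoc, comp_tgt, pullback.lift_snd_assoc, hgh]) ≫ comp =
    pullback.lift f (pullback.lift g h hgh ≫ comp)
      (by rw [Category.assoc, comp_src, pullback.lift_fst_assoc, hfg]) ≫ comp

variable {C}

namespace InternalCat

/-- The composite of two composable generalized elements of the object of arrows. -/
def cmp (X : InternalCat C) {A : C} (f g : A ⟶ X.X₁) (h : f ≫ X.tgt = g ≫ X.src) : A ⟶ X.X₁ :=
  pullback.lift f g h ≫ X.comp

section

variable (X : InternalCat C) {A B : C}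

@[simp]
lemma cmp_src (f g : A ⟶ X.X₁) (h) : X.cmp f g h ≫ X.src = f ≫ X.src := by
  rw [cmp, Category.assoc, X.comp_src, pullback.lift_fst_assoc]

@[simp]
lemma cmp_tgt (f g : A ⟶ X.X₁) (h) : X.cmp f g h ≫ X.tgt = g ≫ X.tgt := by
  rw [cmp, Category.assoc, X.comp_tgt, pullback.lift_snd_assoc]

lemma precomp_cmp (k : B ⟶ A) (f g : A ⟶ X.X₁) (h) :
    k ≫ X.cmp f g h = X.cmp (k ≫ f) (k ≫ g) (by rw [Category.assoc, h, Category.assoc]) := by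
  rw [cmp, cmp, ← Category.assoc]
  congr 1
  ext <;> simp [pullback.lift_fst, pullback.lift_snd]

lemma cmp_assoc (f g k : A ⟶ X.X₁) (hfg : f ≫ X.tgt = g ≫ X.src) (hgk : g ≫ X.tgt = k ≫ X.src) :
    X.cmp (X.cmp f g hfg) k (by rw [cmp_tgt, hgk]) =
      X.cmp f (X.cmp g k hgk) (by rw [cmp_src, hfg]) :=
  X.assoc f g k hfg hgk

lemma ident_cmp (a : A ⟶ X.X₀) (f : A ⟶ X.X₁) (h : (a ≫ X.ident) ≫ X.tgt = f ≫ X.src) :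
    X.cmp (a ≫ X.ident) f h = f := by
  have ha : a = f ≫ X.src := by simpa [X.ident_tgt] using h
  subst ha
  have := congrArg (fun k => f ≫ k) X.ident_comp
  simp only [Category.comp_id] at this
  rw [← Category.assoc] at this
  rw [cmp]
  convert this using 2
  ext <;> simp [pullback.lift_fst, pullback.lift_snd]

lemma cmp_ident (f : A ⟶ X.X₁) (a : A ⟶ X.X₀) (h : f ≫ X.tgt = (a ≫ X.ident) ≫ X.src) :
    X.cmp f (a ≫ X.ident) h = f := by
  have ha : a = f ≫ X.tgt := by simpa [X.ident_src] using h.symm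
  subst ha
  have := congrArg (fun k => f ≫ k) X.comp_ident
  simp only [Category.comp_id] at this
  rw [← Category.assoc] at this
  rw [cmp]
  convert this using 2
  ext <;> simp [pullback.lift_fst, pullback.lift_snd]

lemma cmp_congr {f f' g g' : A ⟶ X.X₁} (hf : f = f') (hg : g = g') (h) :
    X.cmp f g h = X.cmp f' g' (by rw [← hf, ← hg, h]) := by
  subst hf hg; rfl

end

/-- An internal functor. -/
@[ext]
structure Fctr (X Y : InternalCat C) where
  f₀ : X.X₀ ⟶ Y.X₀
  f₁ : X.X₁ ⟶ Y.X₁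
  src : f₁ ≫ Y.src = X.src ≫ f₀
  tgt : f₁ ≫ Y.tgt = X.tgt ≫ f₀
  ident : X.ident ≫ f₁ = f₀ ≫ Y.ident
  comp : X.comp ≫ f₁ = Y.cmp (pullback.fst X.tgt X.src ≫ f₁) (pullback.snd X.tgt X.src ≫ f₁)
    (by rw [Category.assoc, Category.assoc, src, tgt, pullback.condition_assoc])

lemma Fctr.cmp_comp {X Y : InternalCat C} (F : Fctr X Y) {A : C} (f g : A ⟶ X.X₁) (h) :
    X.cmp f g h ≫ F.f₁ = Y.cmp (f ≫ F.f₁) (g ≫ F.f₁)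
      (by rw [Category.assoc, Category.assoc, F.src, F.tgt, reassoc_of% h]) := by
  rw [cmp, Category.assoc, F.comp, precomp_cmp]
  exact cmp_congr _ (by rw [pullback.lift_fst_assoc]) (by rw [pullback.lift_snd_assoc]) _

/-- The identity internal functor. -/
@[simps]
def Fctr.id (X : InternalCat C) : Fctr X X where
  f₀ := 𝟙 _
  f₁ := 𝟙 _
  src := by simp
  tgt := by simp
  ident := by simp
  comp := by
    rw [Category.comp_id, cmp]
    simp only [Category.comp_id]
    rw [show pullback.lift (pullback.fst X.tgt X.src) (pullback.snd X.tgt X.src)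
      pullback.condition = 𝟙 _ by ext <;> simp, Category.id_comp]

/-- Composition of internal functors. -/
@[simps]
def Fctr.then {X Y Z : InternalCat C} (F : Fctr X Y) (G : Fctr Y Z) : Fctr X Z where
  f₀ := F.f₀ ≫ G.f₀
  f₁ := F.f₁ ≫ G.f₁
  src := by rw [Category.assoc, G.src, reassoc_of% F.src]
  tgt := by rw [Category.assoc, G.tgt, reassoc_of% F.tgt]
  ident := by rw [reassoc_of% F.ident, G.ident, Category.assoc]
  comp := by
    rw [← Category.assoc, F.comp, G.cmp_comp]
    exact cmp_congr _ (by simp) (by simp) _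

/-- An internal natural transformation. -/
@[ext]
structure Trans {X Y : InternalCat C} (F G : Fctr X Y) where
  app : X.X₀ ⟶ Y.X₁
  app_src : app ≫ Y.src = F.f₀
  app_tgt : app ≫ Y.tgt = G.f₀
  naturality :
    Y.cmp F.f₁ (X.tgt ≫ app) (by rw [Category.assoc, app_src, F.tgt]) =
      Y.cmp (X.src ≫ app) G.f₁ (by rw [Category.assoc, app_tgt, G.src])

/-- Internal categories and internal functors. -/
instance categoryStruct : CategoryStruct (InternalCat C) where
  Hom X Y := Fctr X Y
  id X := Fctr.id X
  comp F G := Fctr.then F G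

@[ext]
lemma hom_ext {X Y : InternalCat C} {F G : X ⟶ Y} (h₀ : F.f₀ = G.f₀) (h₁ : F.f₁ = G.f₁) : F = G :=
  Fctr.ext h₀ h₁

@[simp] lemma id_f₀ (X : InternalCat C) : (𝟙 X : X ⟶ X).f₀ = 𝟙 X.X₀ := rfl
@[simp] lemma id_f₁ (X : InternalCat C) : (𝟙 X : X ⟶ X).f₁ = 𝟙 X.X₁ := rfl
@[simp] lemma comp_f₀ {X Y Z : InternalCat C} (F : X ⟶ Y) (G : Y ⟶ Z) :
    (F ≫ G).f₀ = F.f₀ ≫ G.f₀ := rfl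
@[simp] lemma comp_f₁ {X Y Z : InternalCat C} (F : X ⟶ Y) (G : Y ⟶ Z) :
    (F ≫ G).f₁ = F.f₁ ≫ G.f₁ := rfl

/-- Internal functors and internal natural transformations form a category. -/
instance homCategory (X Y : InternalCat C) : Category (X ⟶ Y) where
  Hom F G := Trans F G
  id F :=
    { app := F.f₀ ≫ Y.ident
      app_src := by rw [Category.assoc, Y.ident_src, Category.comp_id]
      app_tgt := by rw [Category.assoc, Y.ident_tgt, Category.comp_id]
      naturality := by
        have h₁ := Y.cmp_ident F.f₁ (X.tgt ≫ F.f₀) (by simp [Y.ident_src, F.tgt])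
        have h₂ := Y.ident_cmp (X.src ≫ F.f₀) F.f₁ (by simp [Y.ident_tgt, F.src])
        simp only [Category.assoc] at h₁ h₂
        rw [h₁, h₂] }
  comp {F G H} α β :=
    { app := Y.cmp α.app β.app (by rw [α.app_tgt, β.app_src])
      app_src := by rw [cmp_src, α.app_src]
      app_tgt := by rw [cmp_tgt, β.app_tgt]
      naturality := by
        have e₁ := Y.precomp_cmp X.tgt α.app β.app (by rw [α.app_tgt, β.app_src])
        have e₂ := Y.precomp_cmp X.src α.app β.app (by rw [α.app_tgt, β.app_src])
        rw [Y.cmp_congr rfl e₁, Y.cmp_congr e₂ rfl, ← Y.cmp_assoc _ _ _ (by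
            rw [Category.assoc, α.app_src, F.tgt]), Y.cmp_congr α.naturality rfl,
          Y.cmp_assoc _ _ _ _ (by rw [Category.assoc, β.app_src, G.tgt]),
          Y.cmp_congr rfl β.naturality, Y.cmp_assoc] }
  id_comp {F G} α := Trans.ext (by exact Y.ident_cmp _ _ _)
  comp_id {F G} α := Trans.ext (by exact Y.cmp_ident _ _ _)
  assoc α β γ := Trans.ext (Y.cmp_assoc _ _ _ _ _)

section

variable {X Y Z : InternalCat C}

@[ext]
lemma hom₂_ext {F G : X ⟶ Y} {α β : F ⟶ G} (h : α.app = β.app) : α = β :=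
  Trans.ext h

@[simp] lemma id_app (F : X ⟶ Y) : (𝟙 F : F ⟶ F).app = F.f₀ ≫ Y.ident := rfl

lemma comp_app {F G H : X ⟶ Y} (α : F ⟶ G) (β : G ⟶ H) :
    (α ≫ β).app = Y.cmp α.app β.app (by rw [α.app_tgt, β.app_src]) := rfl

lemma eqToHom_app {F G : X ⟶ Y} (h : F = G) : (eqToHom h).app = F.f₀ ≫ Y.ident := by
  subst h; rfl

/-- Left whiskering of an internal natural transformation by an internal functor. -/
@[simps]
def whiskerL (F : X ⟶ Y) {G H : Y ⟶ Z} (α : G ⟶ H) : (F ≫ G) ⟶ (F ≫ H) where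
  app := F.f₀ ≫ α.app
  app_src := by rw [Category.assoc, α.app_src, comp_f₀]
  app_tgt := by rw [Category.assoc, α.app_tgt, comp_f₀]
  naturality := by
    have := congrArg (fun k => F.f₁ ≫ k) α.naturality
    simp only [precomp_cmp] at this
    convert this using 1
    · exact Z.cmp_congr rfl (by rw [reassoc_of% F.tgt]) _
    · exact Z.cmp_congr (by rw [reassoc_of% F.src]) rfl _

/-- Right whiskering of an internal natural transformation by an internal functor. -/
@[simps]
def whiskerR {F G : X ⟶ Y} (α : F ⟶ G) (H : Y ⟶ Z) : (F ≫ H) ⟶ (G ≫ H) where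
  app := α.app ≫ H.f₁
  app_src := by rw [Category.assoc, H.src, reassoc_of% α.app_src, comp_f₀]
  app_tgt := by rw [Category.assoc, H.tgt, reassoc_of% α.app_tgt, comp_f₀]
  naturality := by
    have := congrArg (fun k => k ≫ H.f₁) α.naturality
    simp only [Fctr.cmp_comp] at this
    convert this using 1
    · exact Z.cmp_congr rfl (by rw [Category.assoc]) _
    · exact Z.cmp_congr (by rw [Category.assoc]) rfl _

end

lemma id_comp' {X Y : InternalCat C} (F : X ⟶ Y) : 𝟙 X ≫ F = F := by
  ext <;> simp

lemma comp_id' {X Y : InternalCat C} (F : X ⟶ Y) : F ≫ 𝟙 Y = F := by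
  ext <;> simp

lemma assoc' {W X Y Z : InternalCat C} (F : W ⟶ X) (G : X ⟶ Y) (H : Y ⟶ Z) :
    (F ≫ G) ≫ H = F ≫ G ≫ H := by
  ext <;> simp

lemma eqToHom_comp' {X Y : InternalCat C} {F G H : X ⟶ Y} (h : F = G) (α : G ⟶ H) :
    (eqToHom h ≫ α).app = α.app := by
  subst h; rw [eqToHom_refl, Category.id_comp]

lemma comp_eqToHom' {X Y : InternalCat C} {F G H : X ⟶ Y} (α : F ⟶ G) (h : G = H) :
    (α ≫ eqToHom h).app = α.app := by
  subst h; rw [eqToHom_refl, Category.comp_id]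

lemma whiskerL_eqToHom' {X Y Z : InternalCat C} (F : X ⟶ Y) {G H : Y ⟶ Z} (h : G = H) :
    whiskerL F (eqToHom h) = eqToHom (by rw [h]) := by
  subst h; ext; simp

lemma whiskerR_eqToHom' {X Y Z : InternalCat C} {F G : X ⟶ Y} (h : F = G) (H : Y ⟶ Z) :
    whiskerR (eqToHom h) H = eqToHom (by rw [h]) := by
  subst h; ext; simp [H.ident]

/-- The 2-category of categories internal to `C`, internal functors and internal natural
transformations. -/
instance bicategory : Bicategory (InternalCat C) where
  toCategoryStruct := categoryStruct
  homCategory := homCategory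
  whiskerLeft F _ _ α := whiskerL F α
  whiskerRight α H := whiskerR α H
  associator F G H := eqToIso (assoc' F G H)
  leftUnitor F := eqToIso (id_comp' F)
  rightUnitor F := eqToIso (comp_id' F)
  whiskerLeft_id F G := by ext; simp
  whiskerLeft_comp F _ _ _ α β := by
    ext; simp only [whiskerL_app, comp_app, precomp_cmp]
  id_whiskerLeft α := by
    ext; simp [eqToHom_comp', comp_eqToHom']
  comp_whiskerLeft F G _ _ α := by
    ext; simp [eqToHom_comp', comp_eqToHom']
  id_whiskerRight F G := by
    ext; simp [G.ident]
  comp_whiskerRight α β H := by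
    ext; simp only [whiskerR_app, comp_app, Fctr.cmp_comp]
  whiskerRight_id α := by
    ext; simp [eqToHom_comp', comp_eqToHom']
  whiskerRight_comp α F G := by
    ext; simp [eqToHom_comp', comp_eqToHom']
  whisker_assoc F _ _ α H := by
    ext; simp [eqToHom_comp', comp_eqToHom']
  whisker_exchange {X Y Z F G H K} α β := by
    ext
    have := congrArg (fun k => α.app ≫ k) β.naturality
    simp only [precomp_cmp] at this
    simp only [whiskerL_app, whiskerR_app, comp_app]
    convert this.symm using 1
    · exact Z.cmp_congr (by rw [reassoc_of% α.app_src]) rfl _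
    · exact Z.cmp_congr rfl (by rw [reassoc_of% α.app_tgt]) _
  pentagon F G H K := by
    simp [whiskerL_eqToHom', whiskerR_eqToHom']
  triangle F G := by
    simp [whiskerL_eqToHom', whiskerR_eqToHom']

instance : Bicategory.Strict (InternalCat C) where
  id_comp := id_comp'
  comp_id := comp_id'
  assoc := assoc'

end InternalCat

end InternalCategories

attribute [-instance] InternalCat.categoryStruct InternalCat.homCategory

/-! ### 2-monads -/

section TwoMonads

open Bicategory

/-- A (strict) 2-natural transformation between 2-functors. -/
structure TwoNatTrans {B : Type*} [Bicategory B] {D : Type*} [Bicategory D]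
    (F G : StrictPseudofunctor B D) where
  app (a : B) : F.obj a ⟶ G.obj a
  naturality {a b : B} (f : a ⟶ b) : F.map f ≫ app b = app a ≫ G.map f
  naturality₂ {a b : B} {f g : a ⟶ b} (θ : f ⟶ g) :
    F.map₂ θ ▷ app b ≫ eqToHom (naturality g) = eqToHom (naturality f) ≫ app a ◁ G.map₂ θ

/-- A 2-monad on a 2-category: a 2-functor `S` with 2-natural transformations `η : 1 ⟶ S` and
`μ : S² ⟶ S` that satisfy the unit laws and the associativity law strictly. -/
structure TwoMonad (B : Type*) [Bicategory B] [Bicategory.Strict B] extends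
    StrictPseudofunctor B B where
  η : TwoNatTrans (StrictPseudofunctor.id B) toStrictPseudofunctor
  μ : TwoNatTrans (toStrictPseudofunctor.comp toStrictPseudofunctor) toStrictPseudofunctor
  left_unit (a : B) : η.app (obj a) ≫ μ.app a = 𝟙 (obj a)
  right_unit (a : B) : map (η.app a) ≫ μ.app a = 𝟙 (obj a)
  assoc (a : B) : map (μ.app a) ≫ μ.app a = μ.app (obj a) ≫ μ.app a

end TwoMonads

/-! ### Lifts of monads to 2-monads -/

section Lifts

/-- The 2-monad `M` on the 2-category of categories internal to `C` is the lift of the monad `T` on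
`C`: it acts on internal categories, internal functors and internal natural transformations by
applying `T` to all structure maps (the composition of `M X` being `T` of the composition of `X`
along the comparison of `T (X₁ ×[X₀] X₁)` with `T X₁ ×[T X₀] T X₁`), and the components of its unit
and multiplication are those of `T` at the objects of objects and of arrows. -/
structure IsInternalLift {C : Type u} [Category.{v} C] [HasPullbacks C] (T : Monad C)
    (M : TwoMonad (InternalCat C)) : Prop where
  obj₀ (X : InternalCat C) : (M.obj X).X₀ = T.obj X.X₀
  obj₁ (X : InternalCat C) : (M.obj X).X₁ = T.obj X.X₁
  src (X : InternalCat C) :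
    (M.obj X).src = eqToHom (obj₁ X) ≫ T.map X.src ≫ eqToHom (obj₀ X).symm
  tgt (X : InternalCat C) :
    (M.obj X).tgt = eqToHom (obj₁ X) ≫ T.map X.tgt ≫ eqToHom (obj₀ X).symm
  ident (X : InternalCat C) :
    (M.obj X).ident = eqToHom (obj₀ X) ≫ T.map X.ident ≫ eqToHom (obj₁ X).symm
  comp (X : InternalCat C) :
    (M.obj X).cmp (T.map (pullback.fst X.tgt X.src) ≫ eqToHom (obj₁ X).symm)
        (T.map (pullback.snd X.tgt X.src) ≫ eqToHom (obj₁ X).symm)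
        (by
          rw [src, tgt]
          simp only [Category.assoc, eqToHom_trans_assoc, eqToHom_refl, Category.id_comp]
          rw [← T.map_comp_assoc, pullback.condition, T.map_comp_assoc]) =
      T.map X.comp ≫ eqToHom (obj₁ X).symm
  map₀ {X Y : InternalCat C} (F : X ⟶ Y) :
    (M.map F).f₀ = eqToHom (obj₀ X) ≫ T.map F.f₀ ≫ eqToHom (obj₀ Y).symm
  map₁ {X Y : InternalCat C} (F : X ⟶ Y) :
    (M.map F).f₁ = eqToHom (obj₁ X) ≫ T.map F.f₁ ≫ eqToHom (obj₁ Y).symm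
  map₂ {X Y : InternalCat C} {F G : X ⟶ Y} (α : F ⟶ G) :
    (M.map₂ α).app = eqToHom (obj₀ X) ≫ T.map α.app ≫ eqToHom (obj₁ Y).symm
  unit₀ (X : InternalCat C) : (M.η.app X).f₀ = T.η.app X.X₀ ≫ eqToHom (obj₀ X).symm
  unit₁ (X : InternalCat C) : (M.η.app X).f₁ = T.η.app X.X₁ ≫ eqToHom (obj₁ X).symm
  mul₀ (X : InternalCat C) : (M.μ.app X).f₀ =
    eqToHom (obj₀ (M.obj X)) ≫ T.map (eqToHom (obj₀ X)) ≫ T.μ.app X.X₀ ≫ eqToHom (obj₀ X).symm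
  mul₁ (X : InternalCat C) : (M.μ.app X).f₁ =
    eqToHom (obj₁ (M.obj X)) ≫ T.map (eqToHom (obj₁ X)) ≫ T.μ.app X.X₁ ≫ eqToHom (obj₁ X).symm

/-- Pairs of composable arrows of a category. -/
structure ComposablePair (𝒞 : Type u) [Category.{u} 𝒞] : Type u where
  {x y z : 𝒞}
  fst : x ⟶ y
  snd : y ⟶ z

/-- The 2-monad `N` on the 2-category of (small) categories is a lift of the monad `T` on sets: the
set of objects of `N 𝒞` is `T` of the set of objects of `𝒞`, the set of all arrows of `N 𝒞` is
identified with `T` of the set of all arrows of `𝒞`, and under these identifications the structure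
maps of `N 𝒞`, the action of `N` on functors and natural transformations, and the unit and
multiplication of `N` are those given by `T`. -/
structure SetMonadLift (T : Monad (Type u)) (N : TwoMonad Cat.{u, u}) where
  ob (𝒞 : Cat.{u, u}) : (N.obj 𝒞 : Type u) = T.obj (𝒞 : Type u)
  ar (𝒞 : Cat.{u, u}) : Arrow (N.obj 𝒞) ≃ T.obj (Arrow 𝒞)
  src (𝒞 : Cat.{u, u}) (f : Arrow (N.obj 𝒞)) :
    cast (ob 𝒞) f.left = T.map (↾ fun g : Arrow 𝒞 => g.left) (ar 𝒞 f)
  tgt (𝒞 : Cat.{u, u}) (f : Arrow (N.obj 𝒞)) :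
    cast (ob 𝒞) f.right = T.map (↾ fun g : Arrow 𝒞 => g.right) (ar 𝒞 f)
  ident (𝒞 : Cat.{u, u}) (x : N.obj 𝒞) :
    ar 𝒞 (Arrow.mk (𝟙 x)) = T.map (↾ fun y : 𝒞 => Arrow.mk (𝟙 y)) (cast (ob 𝒞) x)
  comp (𝒞 : Cat.{u, u}) {x y z : N.obj 𝒞} (f : x ⟶ y) (g : y ⟶ z) (p : T.obj (ComposablePair 𝒞))
    (hf : ar 𝒞 (Arrow.mk f) = T.map (↾ fun q : ComposablePair 𝒞 => Arrow.mk q.fst) p)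
    (hg : ar 𝒞 (Arrow.mk g) = T.map (↾ fun q : ComposablePair 𝒞 => Arrow.mk q.snd) p) :
    ar 𝒞 (Arrow.mk (f ≫ g)) = T.map (↾ fun q : ComposablePair 𝒞 => Arrow.mk (q.fst ≫ q.snd)) p
  map₀ {𝒞 𝒟 : Cat.{u, u}} (F : 𝒞 ⟶ 𝒟) (x : N.obj 𝒞) :
    cast (ob 𝒟) ((N.map F).toFunctor.obj x) = T.map (↾ F.toFunctor.obj) (cast (ob 𝒞) x)
  map₁ {𝒞 𝒟 : Cat.{u, u}} (F : 𝒞 ⟶ 𝒟) {x y : N.obj 𝒞} (f : x ⟶ y) :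
    ar 𝒟 (Arrow.mk ((N.map F).toFunctor.map f)) =
      T.map (↾ fun g : Arrow 𝒞 => Arrow.mk (F.toFunctor.map g.hom)) (ar 𝒞 (Arrow.mk f))
  map₂ {𝒞 𝒟 : Cat.{u, u}} {F G : 𝒞 ⟶ 𝒟} (α : F ⟶ G) (x : N.obj 𝒞) :
    ar 𝒟 (Arrow.mk ((N.map₂ α).toNatTrans.app x)) =
      T.map (↾ fun y : 𝒞 => Arrow.mk (α.toNatTrans.app y)) (cast (ob 𝒞) x)
  unit₀ (𝒞 : Cat.{u, u}) (x : 𝒞) :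
    cast (ob 𝒞) ((N.η.app 𝒞).toFunctor.obj x) = T.η.app (𝒞 : Type u) x
  unit₁ (𝒞 : Cat.{u, u}) {x y : 𝒞} (f : x ⟶ y) :
    ar 𝒞 (Arrow.mk ((N.η.app 𝒞).toFunctor.map f)) = T.η.app (Arrow 𝒞) (Arrow.mk f)
  mul₀ (𝒞 : Cat.{u, u}) (x : N.obj (N.obj 𝒞)) :
    cast (ob 𝒞) ((N.μ.app 𝒞).toFunctor.obj x) =
      T.μ.app (𝒞 : Type u) (T.map (↾ cast (ob 𝒞)) (cast (ob (N.obj 𝒞)) x))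
  mul₁ (𝒞 : Cat.{u, u}) {x y : N.obj (N.obj 𝒞)} (f : x ⟶ y) :
    ar 𝒞 (Arrow.mk ((N.μ.app 𝒞).toFunctor.map f)) =
      T.μ.app (Arrow 𝒞) (T.map (↾ ar 𝒞) (ar (N.obj 𝒞) (Arrow.mk f)))

end Lifts

/-! ### The 2-functor on internal categories induced by a pullback-preserving functor -/

noncomputable section InternalLift

universe v' u'

namespace InternalCat

/-! An internal category consists of objects and morphisms subject to equations on composable pairs
and triples, and these form iterated pullbacks. A functor `F` preserving pullbacks sends the object
of composable pairs to the object of composable pairs of the image span, and likewise for triples,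
so every law of `X` becomes a law of its image. The rule behind all of this is `lift_mapComp`: to
compose two generalized elements of `F X₁`, find one generalized element of `F (X₁ ×[X₀] X₁)`
projecting to them and apply `F` of the composition to it.

For a monad, naturality at source, target, identity, composition and the pullback projections makes
the components of `η` and `μ` internal functors. A 1-cell is determined by its two components and a
2-cell by one morphism, so 2-naturality and the monad laws are naturality and the laws of `T` at
`X₀` and `X₁`. They hold strictly because the objects agree on the nose.

The case of sets is the same argument on elements, carried out directly on small categories instead
of by transport along the equivalence with categories internal to sets; this makes the object set
literally `T` of the object set and keeps the laws strict. An arrow `x ⟶ y` is an element of `T` of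
the set of all arrows whose images under source and target are `x` and `y`. Here `comp_val` plays
the role of `lift_mapComp`, and `functor_ext` removes the transports caused by varying endpoints. -/

lemma isPullback_map {C : Type u} [Category.{v} C] [HasPullbacks C] {D : Type u'}
    [Category.{v'} D] (F : C ⥤ D) [PreservesLimitsOfShape WalkingCospan F] {X Y Z : C}
    (f : X ⟶ Z) (g : Y ⟶ Z) :
    IsPullback (F.map (pullback.fst f g)) (F.map (pullback.snd f g)) (F.map f) (F.map g) :=
  (IsPullback.of_hasPullback f g).map F

/-- Serves the clauses of `IsInternalLift`: when the object identifications are `rfl`, each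
`eqToHom` there is an identity by definition. -/
lemma eq_id_comp_comp_id {C : Type u} [Category.{v} C] {X Y : C} (f : X ⟶ Y) :
    f = 𝟙 X ≫ f ≫ 𝟙 Y := by
  rw [Category.comp_id, Category.id_comp]

lemma eq_id_comp_map_id_comp_comp_id {C : Type u} [Category.{v} C] (T : Monad C) {X Y : C}
    (f : T.obj X ⟶ Y) :
    f = 𝟙 (T.obj X) ≫ T.map (𝟙 X) ≫ f ≫ 𝟙 Y := by
  rw [T.map_id, Category.comp_id, Category.id_comp, Category.id_comp]

section

variable {C : Type u} [Category.{v} C] [HasPullbacks C] {D : Type u'} [Category.{v'} D]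
  [HasPullbacks D] (F : C ⥤ D) [PreservesLimitsOfShape WalkingCospan F]

/-- The image of the composition of an internal category under a pullback-preserving functor. -/
def mapComp (X : InternalCat C) : pullback (F.map X.tgt) (F.map X.src) ⟶ F.obj X.X₁ :=
  (isPullback_map F X.tgt X.src).isoPullback.inv ≫ F.map X.comp

/-- A morphism into `F` of the pullback is determined by its two projections, so any `p` with the
right projections may be used to compute a composite. -/
lemma lift_mapComp (X : InternalCat C) {A : D} (p : A ⟶ F.obj (pullback X.tgt X.src))
    {f g : A ⟶ F.obj X.X₁} (hf : p ≫ F.map (pullback.fst X.tgt X.src) = f)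
    (hg : p ≫ F.map (pullback.snd X.tgt X.src) = g) (h : f ≫ F.map X.tgt = g ≫ F.map X.src) :
    pullback.lift f g h ≫ mapComp F X = p ≫ F.map X.comp := by
  rw [mapComp, ← Category.assoc]
  congr 1
  apply (isPullback_map F X.tgt X.src).hom_ext
  · rw [Category.assoc, IsPullback.isoPullback_inv_fst, pullback.lift_fst, hf]
  · rw [Category.assoc, IsPullback.isoPullback_inv_snd, pullback.lift_snd, hg]

lemma map_lift_mapComp (X : InternalCat C) {A : C} (f g : A ⟶ X.X₁) (h : f ≫ X.tgt = g ≫ X.src)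
    (h' : F.map f ≫ F.map X.tgt = F.map g ≫ F.map X.src) :
    pullback.lift (F.map f) (F.map g) h' ≫ mapComp F X = F.map (pullback.lift f g h ≫ X.comp) := by
  rw [lift_mapComp F X (F.map (pullback.lift f g h)) (by rw [← F.map_comp, pullback.lift_fst])
    (by rw [← F.map_comp, pullback.lift_snd]), F.map_comp]

lemma mapComp_src (X : InternalCat C) :
    mapComp F X ≫ F.map X.src = pullback.fst (F.map X.tgt) (F.map X.src) ≫ F.map X.src := by
  rw [mapComp, Category.assoc, ← F.map_comp, X.comp_src, F.map_comp,
    IsPullback.isoPullback_inv_fst_assoc]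

lemma mapComp_tgt (X : InternalCat C) :
    mapComp F X ≫ F.map X.tgt = pullback.snd (F.map X.tgt) (F.map X.src) ≫ F.map X.tgt := by
  rw [mapComp, Category.assoc, ← F.map_comp, X.comp_tgt, F.map_comp,
    IsPullback.isoPullback_inv_snd_assoc]

/-- The iterated pullback carries the universal composable triple `u ≫ a`, `u ≫ b`, `c`. Since `F`
preserves both pullbacks, `f`, `g`, `k` are the image of that triple precomposed with one morphism
`q`, so the claim is `F` of associativity for the universal triple. -/
lemma mapComp_assoc (X : InternalCat C) {A : D} (f g k : A ⟶ F.obj X.X₁)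
    (hfg : f ≫ F.map X.tgt = g ≫ F.map X.src) (hgk : g ≫ F.map X.tgt = k ≫ F.map X.src) :
    pullback.lift (pullback.lift f g hfg ≫ mapComp F X) k
      (by rw [Category.assoc, mapComp_tgt, pullback.lift_snd_assoc, hgk]) ≫ mapComp F X =
    pullback.lift f (pullback.lift g k hgk ≫ mapComp F X)
      (by rw [Category.assoc, mapComp_src, pullback.lift_fst_assoc, hfg]) ≫ mapComp F X := by
  let a := pullback.fst X.tgt X.src
  let b := pullback.snd X.tgt X.src
  let u := pullback.fst (b ≫ X.tgt) X.src
  let c := pullback.snd (b ≫ X.tgt) X.src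
  have hab : (u ≫ a) ≫ X.tgt = (u ≫ b) ≫ X.src := by
    simp only [Category.assoc, a, b, pullback.condition]
  have hbc : (u ≫ b) ≫ X.tgt = c ≫ X.src := by
    simpa only [Category.assoc, u, c] using pullback.condition (f := b ≫ X.tgt) (g := X.src)
  let p : A ⟶ F.obj (pullback X.tgt X.src) := (isPullback_map F X.tgt X.src).lift f g hfg
  have pa : p ≫ F.map a = f := IsPullback.lift_fst _ _ _ _
  have pb : p ≫ F.map b = g := IsPullback.lift_snd _ _ _ _
  let q : A ⟶ F.obj (pullback (b ≫ X.tgt) X.src) :=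
    (isPullback_map F (b ≫ X.tgt) X.src).lift p k (by rw [F.map_comp, reassoc_of% pb, hgk])
  have qu : q ≫ F.map u = p := IsPullback.lift_fst _ _ _ _
  have qc : q ≫ F.map c = k := IsPullback.lift_snd _ _ _ _
  have e₁ : pullback.lift f g hfg ≫ mapComp F X = q ≫ F.map (X.cmp (u ≫ a) (u ≫ b) hab) := by
    rw [lift_mapComp F X (q ≫ F.map (pullback.lift (u ≫ a) (u ≫ b) hab)), cmp, F.map_comp,
      Category.assoc]
    · rw [Category.assoc, ← F.map_comp, pullback.lift_fst, F.map_comp, reassoc_of% qu, pa]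
    · rw [Category.assoc, ← F.map_comp, pullback.lift_snd, F.map_comp, reassoc_of% qu, pb]
  have e₂ : pullback.lift g k hgk ≫ mapComp F X = q ≫ F.map (X.cmp (u ≫ b) c hbc) := by
    rw [lift_mapComp F X (q ≫ F.map (pullback.lift (u ≫ b) c hbc)), cmp, F.map_comp,
      Category.assoc]
    · rw [Category.assoc, ← F.map_comp, pullback.lift_fst, F.map_comp, reassoc_of% qu, pb]
    · rw [Category.assoc, ← F.map_comp, pullback.lift_snd, qc]
  have h₁ : X.cmp (u ≫ a) (u ≫ b) hab ≫ X.tgt = c ≫ X.src := by rw [cmp_tgt, hbc]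
  have h₂ : (u ≫ a) ≫ X.tgt = X.cmp (u ≫ b) c hbc ≫ X.src := by rw [cmp_src, hab]
  rw [lift_mapComp F X (q ≫ F.map (pullback.lift (X.cmp (u ≫ a) (u ≫ b) hab) c h₁))
      (by rw [Category.assoc, ← F.map_comp, pullback.lift_fst, e₁])
      (by rw [Category.assoc, ← F.map_comp, pullback.lift_snd, qc]),
    lift_mapComp F X (q ≫ F.map (pullback.lift (u ≫ a) (X.cmp (u ≫ b) c hbc) h₂))
      (by rw [Category.assoc, ← F.map_comp, pullback.lift_fst, F.map_comp, reassoc_of% qu, pa])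
      (by rw [Category.assoc, ← F.map_comp, pullback.lift_snd, e₂]),
    Category.assoc, Category.assoc]
  refine congrArg (q ≫ ·) ?_
  exact (F.map_comp _ _).symm.trans
    ((congrArg F.map (X.cmp_assoc _ _ _ hab hbc)).trans (F.map_comp _ _))

/-- The image of an internal category under a pullback-preserving functor. -/
abbrev mapObj (X : InternalCat C) : InternalCat D where
  X₀ := F.obj X.X₀
  X₁ := F.obj X.X₁
  src := F.map X.src
  tgt := F.map X.tgt
  ident := F.map X.ident
  comp := mapComp F X
  ident_src := by rw [← F.map_comp, X.ident_src, F.map_id]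
  ident_tgt := by rw [← F.map_comp, X.ident_tgt, F.map_id]
  comp_src := mapComp_src F X
  comp_tgt := mapComp_tgt F X
  ident_comp := by
    rw [lift_mapComp F X (F.map (pullback.lift (X.src ≫ X.ident) (𝟙 X.X₁)
      (by rw [Category.assoc, X.ident_tgt, Category.comp_id, Category.id_comp]))), ← F.map_comp,
      X.ident_comp, F.map_id]
    · rw [← F.map_comp, pullback.lift_fst, F.map_comp]
    · rw [← F.map_comp, pullback.lift_snd, F.map_id]
  comp_ident := by
    rw [lift_mapComp F X (F.map (pullback.lift (𝟙 X.X₁) (X.tgt ≫ X.ident)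
      (by rw [Category.assoc, X.ident_src, Category.comp_id, Category.id_comp]))), ← F.map_comp,
      X.comp_ident, F.map_id]
    · rw [← F.map_comp, pullback.lift_fst, F.map_id]
    · rw [← F.map_comp, pullback.lift_snd, F.map_comp]
  assoc := mapComp_assoc F X

lemma map_cmp (X : InternalCat C) {A : C} (f g : A ⟶ X.X₁) (h : f ≫ X.tgt = g ≫ X.src) :
    F.map (X.cmp f g h) = (mapObj F X).cmp (F.map f) (F.map g)
      (by rw [← F.map_comp, h, F.map_comp]) :=
  (map_lift_mapComp F X f g h _).symm

/-- The image of an internal functor under a pullback-preserving functor. -/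
@[simps]
def mapFctr {X Y : InternalCat C} (H : X ⟶ Y) : Fctr (mapObj F X) (mapObj F Y) where
  f₀ := F.map H.f₀
  f₁ := F.map H.f₁
  src := by rw [← F.map_comp, H.src, F.map_comp]
  tgt := by rw [← F.map_comp, H.tgt, F.map_comp]
  ident := by rw [← F.map_comp, H.ident, F.map_comp]
  comp := by
    change mapComp F X ≫ F.map H.f₁ = _
    rw [mapComp, Category.assoc, ← F.map_comp, H.comp, map_cmp, precomp_cmp]
    refine cmp_congr _ ?_ ?_ _
    · rw [F.map_comp, IsPullback.isoPullback_inv_fst_assoc]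
    · rw [F.map_comp, IsPullback.isoPullback_inv_snd_assoc]

/-- The image of an internal natural transformation under a pullback-preserving functor. -/
@[simps]
def mapTrans {X Y : InternalCat C} {H K : X ⟶ Y} (α : H ⟶ K) :
    Trans (mapFctr F H) (mapFctr F K) where
  app := F.map α.app
  app_src := by rw [← F.map_comp, α.app_src, mapFctr_f₀]
  app_tgt := by rw [← F.map_comp, α.app_tgt, mapFctr_f₀]
  naturality := by
    have h := congrArg F.map α.naturality
    rw [map_cmp, map_cmp] at h
    exact (cmp_congr _ rfl (F.map_comp _ _).symm _).trans
      (h.trans (cmp_congr _ (F.map_comp _ _) rfl _))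

/-- The 2-functor between 2-categories of internal categories induced by a pullback-preserving
functor. -/
def mapTwoFunctor : StrictPseudofunctor (InternalCat C) (InternalCat D) :=
  StrictPseudofunctor.mk''
    { obj := mapObj F
      map H := mapFctr F H
      map₂ α := mapTrans F α
      map₂_id H := by
        ext
        exact F.map_comp _ _
      map₂_comp α β := by
        ext
        exact map_cmp F _ _ _ _
      map_id X := by
        ext
        · exact F.map_id _
        · exact F.map_id _
      map_comp H K := by
        ext
        · exact F.map_comp _ _
        · exact F.map_comp _ _
      map₂_whisker_left H _ _ α := by
        ext
        -- The coherence cells are `eqToHom`s, which do not change the underlying morphism.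
        rw [eqToHom_comp', comp_eqToHom']
        exact F.map_comp _ _
      map₂_whisker_right α H := by
        ext
        rw [eqToHom_comp', comp_eqToHom']
        exact F.map_comp _ _ }

end

/-! ### Unit and multiplication on internal categories. -/

section

variable {C : Type u} [Category.{v} C] [HasPullbacks C] (T : Monad C)
  [PreservesLimitsOfShape WalkingCospan T.toFunctor]

/-- The unit of a monad as an internal functor. -/
@[simps]
def unitFctr (X : InternalCat C) : Fctr X (mapObj T.toFunctor X) where
  f₀ := T.η.app X.X₀
  f₁ := T.η.app X.X₁
  src := (T.η.naturality X.src).symm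
  tgt := (T.η.naturality X.tgt).symm
  ident := T.η.naturality X.ident
  comp := by
    rw [← Functor.id_map X.comp, ← Functor.id_map X.comp]
    refine (T.η.naturality X.comp).trans ?_
    -- The element of `T` of the composable pairs is `η` at the pullback; its projections are
    -- computed by naturality.
    refine (lift_mapComp T.toFunctor X _ ?_ ?_ _).symm
    · exact (T.η.naturality _).symm
    · exact (T.η.naturality _).symm

/-- The multiplication of a monad as an internal functor. -/
@[simps]
def mulFctr (X : InternalCat C) :
    Fctr (mapObj T.toFunctor (mapObj T.toFunctor X)) (mapObj T.toFunctor X) where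
  f₀ := T.μ.app X.X₀
  f₁ := T.μ.app X.X₁
  src := (T.μ.naturality X.src).symm
  tgt := (T.μ.naturality X.tgt).symm
  ident := T.μ.naturality X.ident
  comp := by
    have e := (isPullback_map T.toFunctor X.tgt X.src).map T.toFunctor
    have w : T.map (pullback.fst X.tgt X.src) ≫ T.map X.tgt =
        T.map (pullback.snd X.tgt X.src) ≫ T.map X.src :=
      (isPullback_map T.toFunctor X.tgt X.src).w
    have h₁ := lift_mapComp T.toFunctor (mapObj T.toFunctor X)
      (e.isoPullback.inv ≫ T.map (pullback.lift _ _ w)) (f := pullback.fst _ _)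
      (g := pullback.snd _ _)
      (by rw [Category.assoc, ← T.map_comp, pullback.lift_fst, e.isoPullback_inv_fst])
      (by rw [Category.assoc, ← T.map_comp, pullback.lift_snd, e.isoPullback_inv_snd])
      pullback.condition
    have h₂ : pullback.lift _ _ w ≫ (mapObj T.toFunctor X).comp = T.map X.comp := by
      have := lift_mapComp T.toFunctor X (𝟙 _) (Category.id_comp _) (Category.id_comp _) w
      rwa [Category.id_comp] at this
    have h₃ : pullback.lift (pullback.fst (T.map (T.map X.tgt)) (T.map (T.map X.src)))
        (pullback.snd _ _) pullback.condition = 𝟙 _ := by ext <;> simp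
    -- Applying `T` twice, one comparison at a time, gives the same composition as the single
    -- comparison `e` for the square of `T`; naturality of `μ` at `X.comp` then applies.
    have h₄ : mapComp T.toFunctor (mapObj T.toFunctor X) =
        e.isoPullback.inv ≫ T.map (T.map X.comp) := by
      rw [← h₂, T.map_comp, ← Category.assoc, ← h₁]
      exact (Category.id_comp _).symm.trans (congrArg (· ≫ mapComp _ _) h₃.symm)
    refine (congrArg (· ≫ T.μ.app X.X₁) h₄).trans ((Category.assoc _ _ _).trans
      ((congrArg (e.isoPullback.inv ≫ ·) (T.μ.naturality X.comp)).trans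
      ((Category.assoc _ _ _).symm.trans (lift_mapComp T.toFunctor X _ ?_ ?_ _).symm)))
    · rw [Category.assoc, ← T.μ.naturality, Functor.comp_map, e.isoPullback_inv_fst_assoc]
    · rw [Category.assoc, ← T.μ.naturality, Functor.comp_map, e.isoPullback_inv_snd_assoc]

/-- The 2-monad on internal categories induced by a monad that preserves pullbacks. -/
def mapTwoMonad : TwoMonad (InternalCat C) where
  toStrictPseudofunctor := mapTwoFunctor T.toFunctor
  η :=
    { app X := unitFctr T X
      naturality H := by
        ext
        · exact T.η.naturality _
        · exact T.η.naturality _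
      naturality₂ α := by
        ext
        rw [eqToHom_comp', comp_eqToHom']
        exact T.η.naturality _ }
  μ :=
    { app X := mulFctr T X
      naturality H := by
        ext
        · exact T.μ.naturality _
        · exact T.μ.naturality _
      naturality₂ α := by
        ext
        rw [eqToHom_comp', comp_eqToHom']
        exact T.μ.naturality _ }
  left_unit X := by
    ext
    · exact T.left_unit _
    · exact T.left_unit _
  right_unit X := by
    ext
    · exact T.right_unit _
    · exact T.right_unit _
  assoc X := by
    ext
    · exact T.assoc _
    · exact T.assoc _

lemma isInternalLift_mapTwoMonad : IsInternalLift T (mapTwoMonad T) where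
  obj₀ X := rfl
  obj₁ X := rfl
  src X := eq_id_comp_comp_id _
  tgt X := eq_id_comp_comp_id _
  ident X := eq_id_comp_comp_id _
  comp X := by
    refine Eq.trans ?_ (Category.comp_id _).symm
    -- The two projections are the image of the universal composable pair, hence the witness `𝟙`.
    refine (lift_mapComp T.toFunctor X (𝟙 _) ?_ ?_ _).trans (Category.id_comp _)
    · exact (Category.id_comp _).trans (Category.comp_id _).symm
    · exact (Category.id_comp _).trans (Category.comp_id _).symm
  map₀ F := eq_id_comp_comp_id _
  map₁ F := eq_id_comp_comp_id _
  map₂ α := eq_id_comp_comp_id _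
  unit₀ X := (Category.comp_id _).symm
  unit₁ X := (Category.comp_id _).symm
  mul₀ X := eq_id_comp_map_id_comp_comp_id T _
  mul₁ X := eq_id_comp_map_id_comp_comp_id T _

end

end InternalCat

end InternalLift

/-! ### The 2-functor on small categories induced by a pullback-preserving functor on sets -/

noncomputable section SetLift

namespace SetLift

/-! ### Elements of the values of an endofunctor of sets. -/

section

variable (F : Type u ⥤ Type u)

/-- The action of an endofunctor of the category of sets on a function. -/
def act {X Y : Type u} (g : X → Y) (x : F.obj X) : F.obj Y := F.map (↾ g) x

lemma act_act {X Y Z : Type u} (h : Y → Z) (g : X → Y) (x : F.obj X) :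
    act F h (act F g x) = act F (fun a => h (g a)) x :=
  (types_congr_hom (F.map_comp (↾ g) (↾ h)) x).symm

lemma act_id {X : Type u} (x : F.obj X) : act F (fun a => a) x = x :=
  types_congr_hom (F.map_id X) x

lemma act_eq_self {X : Type u} {g : X → X} (h : ∀ a, g a = a) (x : F.obj X) : act F g x = x := by
  rw [funext h, act_id]

lemma act_congr {X Y : Type u} {g h : X → Y} (e : ∀ a, g a = h a) (x : F.obj X) :
    act F g x = act F h x := by
  rw [funext e]

lemma natTrans_act {F} {G : Type u ⥤ Type u} (τ : F ⟶ G) {X Y : Type u} (g : X → Y) (x : F.obj X) :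
    τ.app Y (act F g x) = act G g (τ.app X x) :=
  types_congr_hom (τ.naturality (↾ g)) x

end

/-- Triples of composable arrows of a category. -/
structure ComposableTriple (𝒞 : Type u) [Category.{u} 𝒞] : Type u where
  {w x y z : 𝒞}
  fst : w ⟶ x
  snd : x ⟶ y
  thd : y ⟶ z

/-! ### The lifted category of a small category. -/

section

variable (F : Type u ⥤ Type u)

/-- The set of objects of the category obtained by applying `F` to the sets of objects and of arrows
of the category `𝒞`. -/
def Lift (𝒞 : Type u) : Type u := F.obj 𝒞

section

variable (𝒞 : Type u) [Category.{u} 𝒞]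

lemma isPullback_composablePair :
    IsPullback (↾ fun q : ComposablePair 𝒞 => Arrow.mk q.fst)
      (↾ fun q : ComposablePair 𝒞 => Arrow.mk q.snd)
      (↾ fun g : Arrow 𝒞 => g.right) (↾ fun g : Arrow 𝒞 => g.left) := by
  rw [Types.isPullback_iff]
  refine ⟨rfl, ?_, ?_⟩
  · rintro ⟨f, g⟩ ⟨f', g'⟩ ⟨h₁, h₂⟩
    cases h₁
    cases h₂
    rfl
  · rintro ⟨x, y, f⟩ ⟨y', z, g⟩ h
    cases h
    exact ⟨⟨f, g⟩, rfl, rfl⟩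

/-- A triple is two pairs overlapping in the middle arrow. This form lets two pairs already chosen
for `f`, `g` and `g`, `h` be glued along `g`. -/
lemma isPullback_composableTriple :
    IsPullback (↾ fun t : ComposableTriple 𝒞 => ComposablePair.mk t.fst t.snd)
      (↾ fun t : ComposableTriple 𝒞 => ComposablePair.mk t.snd t.thd)
      (↾ fun q : ComposablePair 𝒞 => Arrow.mk q.snd)
      (↾ fun q : ComposablePair 𝒞 => Arrow.mk q.fst) := by
  rw [Types.isPullback_iff]
  refine ⟨rfl, ?_, ?_⟩
  · rintro ⟨f, g, h⟩ ⟨f', g', h'⟩ ⟨h₁, h₂⟩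
    cases h₁
    cases h₂
    rfl
  · rintro ⟨f, g⟩ ⟨g', h⟩ e
    cases e
    exact ⟨⟨f, g, h⟩, rfl, rfl⟩

end

variable {F} {𝒞 : Type u} [Category.{u} 𝒞]

/-- An arrow from `x` to `y` in the category obtained by applying `F` to the sets of objects and of
arrows of the category `𝒞`. -/
@[ext]
structure Lift.Hom (x y : Lift F 𝒞) : Type u where
  val : F.obj (Arrow 𝒞)
  src : act F (fun g : Arrow 𝒞 => g.left) val = x
  tgt : act F (fun g : Arrow 𝒞 => g.right) val = y

lemma act_src {x y : Lift F 𝒞} (f : Lift.Hom x y) {Z : Type u} (k : 𝒞 → Z) :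
    act F (fun g : Arrow 𝒞 => k g.left) f.val = act F k x :=
  (act_act F k _ _).symm.trans (congrArg (act F k) f.src)

lemma act_tgt {x y : Lift F 𝒞} (f : Lift.Hom x y) {Z : Type u} (k : 𝒞 → Z) :
    act F (fun g : Arrow 𝒞 => k g.right) f.val = act F k y :=
  (act_act F k _ _).symm.trans (congrArg (act F k) f.tgt)

variable [PreservesLimitsOfShape WalkingCospan F]

/-- Existence half of the preserved pullback; `pair_ext` is the uniqueness half. -/
lemma exists_pair {x y z : Lift F 𝒞} (f : Lift.Hom x y) (g : Lift.Hom y z) :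
    ∃ p : F.obj (ComposablePair 𝒞), act F (fun q => Arrow.mk q.fst) p = f.val ∧
      act F (fun q => Arrow.mk q.snd) p = g.val :=
  Types.exists_of_isPullback ((isPullback_composablePair 𝒞).map F) f.val g.val
    (f.tgt.trans g.src.symm)

lemma pair_ext {p q : F.obj (ComposablePair 𝒞)}
    (h₁ : act F (fun q => Arrow.mk q.fst) p = act F (fun q => Arrow.mk q.fst) q)
    (h₂ : act F (fun q => Arrow.mk q.snd) p = act F (fun q => Arrow.mk q.snd) q) : p = q :=
  Types.ext_of_isPullback ((isPullback_composablePair 𝒞).map F) h₁ h₂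

lemma exists_triple {p q : F.obj (ComposablePair 𝒞)}
    (h : act F (fun q => Arrow.mk q.snd) p = act F (fun q => Arrow.mk q.fst) q) :
    ∃ t : F.obj (ComposableTriple 𝒞), act F (fun t => ComposablePair.mk t.fst t.snd) t = p ∧
      act F (fun t => ComposablePair.mk t.snd t.thd) t = q :=
  Types.exists_of_isPullback ((isPullback_composableTriple 𝒞).map F) p q h

/-- The element of `F` of the set of composable pairs that corresponds to two composable arrows. -/
def pair {x y z : Lift F 𝒞} (f : Lift.Hom x y) (g : Lift.Hom y z) : F.obj (ComposablePair 𝒞) :=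
  (exists_pair f g).choose

lemma act_fst_pair {x y z : Lift F 𝒞} (f : Lift.Hom x y) (g : Lift.Hom y z) :
    act F (fun q => Arrow.mk q.fst) (pair f g) = f.val :=
  (exists_pair f g).choose_spec.1

lemma act_snd_pair {x y z : Lift F 𝒞} (f : Lift.Hom x y) (g : Lift.Hom y z) :
    act F (fun q => Arrow.mk q.snd) (pair f g) = g.val :=
  (exists_pair f g).choose_spec.2

lemma eq_pair {x y z : Lift F 𝒞} {f : Lift.Hom x y} {g : Lift.Hom y z}
    {p : F.obj (ComposablePair 𝒞)} (hf : act F (fun q => Arrow.mk q.fst) p = f.val)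
    (hg : act F (fun q => Arrow.mk q.snd) p = g.val) : pair f g = p :=
  pair_ext (by rw [act_fst_pair, hf]) (by rw [act_snd_pair, hg])

instance : CategoryStruct (Lift F 𝒞) where
  Hom := Lift.Hom
  id x :=
    { val := act F (fun y : 𝒞 => Arrow.mk (𝟙 y)) x
      src := (act_act _ _ _ _).trans (act_id F x)
      tgt := (act_act _ _ _ _).trans (act_id F x) }
  comp f g :=
    { val := act F (fun q => Arrow.mk (q.fst ≫ q.snd)) (pair f g)
      src := (act_act _ _ _ _).trans ((act_act _ (fun g : Arrow 𝒞 => g.left)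
        (fun q : ComposablePair 𝒞 => Arrow.mk q.fst) _).symm.trans
        ((congrArg _ (act_fst_pair f g)).trans f.src))
      tgt := (act_act _ _ _ _).trans ((act_act _ (fun g : Arrow 𝒞 => g.right)
        (fun q : ComposablePair 𝒞 => Arrow.mk q.snd) _).symm.trans
        ((congrArg _ (act_snd_pair f g)).trans g.tgt)) }

/-- Frees composition from the choice made in `pair`. Later laws follow by taking for `p` the image
of an explicit pair-valued function. -/
lemma comp_val {x y z : Lift F 𝒞} {f : x ⟶ y} {g : y ⟶ z} (p : F.obj (ComposablePair 𝒞))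
    (hf : act F (fun q => Arrow.mk q.fst) p = f.val)
    (hg : act F (fun q => Arrow.mk q.snd) p = g.val) :
    (f ≫ g).val = act F (fun q => Arrow.mk (q.fst ≫ q.snd)) p :=
  congrArg (act F _) (eq_pair hf hg)

lemma lift_hom_ext {x y : Lift F 𝒞} {f g : x ⟶ y} (h : f.val = g.val) : f = g :=
  Lift.Hom.ext h

/-- The category obtained by applying `F` to the sets of objects and of arrows of a category. -/
instance : Category (Lift F 𝒞) where
  id_comp {x y} f := by
    apply lift_hom_ext
    rw [comp_val (act F (fun g : Arrow 𝒞 => ⟨𝟙 g.left, g.hom⟩) f.val), act_act]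
    · exact act_eq_self F (fun g => by simp) _
    · exact (act_act _ _ _ _).trans (act_src f (fun y => Arrow.mk (𝟙 y)))
    · rw [act_act]
      exact act_eq_self F (fun g => by simp) _
  comp_id {x y} f := by
    apply lift_hom_ext
    rw [comp_val (act F (fun g : Arrow 𝒞 => ⟨g.hom, 𝟙 g.right⟩) f.val), act_act]
    · exact act_eq_self F (fun g => by simp) _
    · rw [act_act]
      exact act_eq_self F (fun g => by simp) _
    · exact (act_act _ _ _ _).trans (act_tgt f (fun y => Arrow.mk (𝟙 y)))
  assoc {_ _ _ _} f g h := by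
    apply lift_hom_ext
    -- All composites are computed from this one `t`, so associativity reduces to associativity in
    -- `𝒞` under `F`.
    obtain ⟨t, h₁, h₂⟩ := exists_triple ((act_snd_pair f g).trans (act_fst_pair g h).symm)
    have hfg : (f ≫ g).val = act F (fun t => Arrow.mk (t.fst ≫ t.snd)) t := by
      rw [comp_val _ (act_fst_pair f g) (act_snd_pair f g), ← h₁, act_act]
    have hgh : (g ≫ h).val = act F (fun t => Arrow.mk (t.snd ≫ t.thd)) t := by
      rw [comp_val _ (act_fst_pair g h) (act_snd_pair g h), ← h₂, act_act]
    rw [comp_val (act F (fun t => ⟨t.fst ≫ t.snd, t.thd⟩) t),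
      comp_val (act F (fun t => ⟨t.fst, t.snd ≫ t.thd⟩) t), act_act, act_act]
    · exact act_congr F (fun t => by simp) t
    · rw [act_act, ← act_fst_pair f g, ← h₁, act_act]
    · rw [act_act, hgh]
    · rw [act_act, hfg]
    · rw [act_act, ← act_snd_pair g h, ← h₂, act_act]

lemma eqToHom_comp_val {x x' y : Lift F 𝒞} (h : x = x') (f : x' ⟶ y) :
    (eqToHom h ≫ f).val = f.val := by
  subst h
  rw [eqToHom_refl, Category.id_comp]

lemma comp_eqToHom_val {x y y' : Lift F 𝒞} (f : x ⟶ y) (h : y = y') :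
    (f ≫ eqToHom h).val = f.val := by
  subst h
  rw [eqToHom_refl, Category.comp_id]

lemma eqToHom_comp_app_val {𝒜 : Cat.{u, u}} {G H K : 𝒜 ⟶ Cat.of (Lift F 𝒞)} (h : G = H)
    (α : H ⟶ K) (x : 𝒜) :
    Lift.Hom.val ((eqToHom h ≫ α).toNatTrans.app x) = Lift.Hom.val (α.toNatTrans.app x) := by
  subst h
  rw [eqToHom_refl, Category.id_comp]

lemma comp_eqToHom_app_val {𝒜 : Cat.{u, u}} {G H K : 𝒜 ⟶ Cat.of (Lift F 𝒞)} (α : G ⟶ H)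
    (h : H = K) (x : 𝒜) :
    Lift.Hom.val ((α ≫ eqToHom h).toNatTrans.app x) = Lift.Hom.val (α.toNatTrans.app x) := by
  subst h
  rw [eqToHom_refl, Category.comp_id]

/-- The transports in functor equality are `eqToHom`s, and composing with these leaves `val`
unchanged. -/
lemma functor_ext {𝒜 : Type*} [Category* 𝒜] {G H : 𝒜 ⥤ Lift F 𝒞} (h₀ : ∀ x, G.obj x = H.obj x)
    (h₁ : ∀ {x y} (f : x ⟶ y), (G.map f).val = (H.map f).val) : G = H :=
  CategoryTheory.Functor.ext h₀ fun x y f => lift_hom_ext (by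
    rw [eqToHom_comp_val, comp_eqToHom_val, h₁])

variable (F 𝒞) in
/-- The set of all arrows of `Lift F 𝒞` is `F` of the set of all arrows of `𝒞`. -/
def arrowEquiv : Arrow (Lift F 𝒞) ≃ F.obj (Arrow 𝒞) where
  toFun f := f.hom.val
  invFun a := Arrow.mk (Y := act F (fun g : Arrow 𝒞 => g.right) a) (Lift.Hom.mk a rfl rfl)
  left_inv := by
    rintro ⟨x, y, ⟨a, h₁, h₂⟩⟩
    cases h₁
    cases h₂
    rfl
  right_inv a := rfl

/-! ### Lifting functors and natural transformations. -/

variable (F) {𝒟 : Type u} [Category.{u} 𝒟]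

/-- The action of `Lift F` on functors. -/
def mapFunctor (H : 𝒞 ⥤ 𝒟) : Lift F 𝒞 ⥤ Lift F 𝒟 where
  obj x := act F H.obj x
  map {x y} f :=
    Lift.Hom.mk (act F (fun g : Arrow 𝒞 => Arrow.mk (H.map g.hom)) f.val)
      ((act_act _ _ _ _).trans (act_src f H.obj)) ((act_act _ _ _ _).trans (act_tgt f H.obj))
  map_id x := by
    apply lift_hom_ext
    refine (act_act _ _ _ _).trans ((act_congr F (fun a => ?_) _).trans (act_act _ _ _ _).symm)
    simp
  map_comp f g := by
    refine lift_hom_ext (Eq.trans ?_ (comp_val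
      (act F (fun q : ComposablePair 𝒞 => ⟨H.map q.fst, H.map q.snd⟩) (pair f g)) ?_ ?_).symm)
    · refine (act_act _ _ _ _).trans ((act_congr F (fun a => ?_) _).trans (act_act _ _ _ _).symm)
      simp
    · exact (act_act _ _ _ _).trans ((act_act F (fun g : Arrow 𝒞 => Arrow.mk (H.map g.hom))
        (fun q : ComposablePair 𝒞 => Arrow.mk q.fst) _).symm.trans
        (congrArg _ (act_fst_pair f g)))
    · exact (act_act _ _ _ _).trans ((act_act F (fun g : Arrow 𝒞 => Arrow.mk (H.map g.hom))
        (fun q : ComposablePair 𝒞 => Arrow.mk q.snd) _).symm.trans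
        (congrArg _ (act_snd_pair f g)))

lemma mapFunctor_map_val (H : 𝒞 ⥤ 𝒟) {x y : Lift F 𝒞} (f : x ⟶ y) :
    ((mapFunctor F H).map f).val = act F (fun g : Arrow 𝒞 => Arrow.mk (H.map g.hom)) f.val :=
  rfl

/-- The action of `Lift F` on natural transformations. -/
def mapNatTrans {H K : 𝒞 ⥤ 𝒟} (α : H ⟶ K) : mapFunctor F H ⟶ mapFunctor F K where
  app x := Lift.Hom.mk (act F (fun y => Arrow.mk (α.app y)) x) (act_act _ _ _ _) (act_act _ _ _ _)
  naturality x y f := by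
    apply lift_hom_ext
    -- The two pairs are the two ways around the naturality square of `α` at `g`.
    rw [comp_val (act F (fun g : Arrow 𝒞 => ⟨H.map g.hom, α.app g.right⟩) f.val),
      comp_val (act F (fun g : Arrow 𝒞 => ⟨α.app g.left, K.map g.hom⟩) f.val), act_act, act_act]
    · exact act_congr F (fun g => by simp) _
    · exact (act_act _ _ _ _).trans (act_src f (fun y => Arrow.mk (α.app y)))
    · rw [act_act, mapFunctor_map_val]
    · rw [act_act, mapFunctor_map_val]
    · exact (act_act _ _ _ _).trans (act_tgt f (fun y => Arrow.mk (α.app y)))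

lemma mapFunctor_id : mapFunctor F (𝟭 𝒞) = 𝟭 (Lift F 𝒞) :=
  functor_ext (act_id F) (fun f => act_id F f.val)

lemma mapFunctor_comp {ℰ : Type u} [Category.{u} ℰ] (H : 𝒞 ⥤ 𝒟) (K : 𝒟 ⥤ ℰ) :
    mapFunctor F (H ⋙ K) = mapFunctor F H ⋙ mapFunctor F K :=
  functor_ext (fun x => (act_act F K.obj H.obj x).symm) (fun f =>
    (act_act F (fun g : Arrow 𝒟 => Arrow.mk (K.map g.hom))
      (fun g : Arrow 𝒞 => Arrow.mk (H.map g.hom)) f.val).symm)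

lemma mapNatTrans_id (H : 𝒞 ⥤ 𝒟) : mapNatTrans F (𝟙 H) = 𝟙 (mapFunctor F H) := by
  ext x
  exact lift_hom_ext (act_act F (fun y : 𝒟 => Arrow.mk (𝟙 y)) H.obj x).symm

lemma mapNatTrans_comp {H K L : 𝒞 ⥤ 𝒟} (α : H ⟶ K) (β : K ⟶ L) :
    mapNatTrans F (α ≫ β) = mapNatTrans F α ≫ mapNatTrans F β := by
  ext x
  refine lift_hom_ext (Eq.trans ?_ (comp_val (act F (fun y => ⟨α.app y, β.app y⟩) x) ?_ ?_).symm)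
  · exact (act_act F (fun q : ComposablePair 𝒟 => Arrow.mk (q.fst ≫ q.snd))
      (fun y : 𝒞 => ⟨α.app y, β.app y⟩) x).symm
  · exact act_act _ _ _ _
  · exact act_act _ _ _ _

/-- The 2-functor on small categories that applies `F` to the sets of objects and of arrows. -/
def twoFunctor : StrictPseudofunctor Cat.{u, u} Cat.{u, u} :=
  StrictPseudofunctor.mk''
    { obj 𝒞 := Cat.of (Lift F 𝒞)
      map H := (mapFunctor F H.toFunctor).toCatHom
      map₂ α := (mapNatTrans F α.toNatTrans).toCatHom₂
      map₂_id H := Cat.Hom₂.ext (mapNatTrans_id F H.toFunctor)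
      map₂_comp α β := Cat.Hom₂.ext (mapNatTrans_comp F α.toNatTrans β.toNatTrans)
      map_id 𝒞 := Cat.ext (mapFunctor_id F)
      map_comp H K := Cat.ext (mapFunctor_comp F H.toFunctor K.toFunctor)
      map₂_whisker_left H _ _ α := by
        ext x
        refine lift_hom_ext (Eq.trans ?_ ((eqToHom_comp_app_val _ _ x).trans
          (comp_eqToHom_app_val _ _ x)).symm)
        exact (act_act F (fun y => Arrow.mk (α.toNatTrans.app y)) H.toFunctor.obj x).symm
      map₂_whisker_right α H := by
        ext x
        refine lift_hom_ext (Eq.trans ?_ ((eqToHom_comp_app_val _ _ x).trans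
          (comp_eqToHom_app_val _ _ x)).symm)
        exact (act_act F (fun g : Arrow _ => Arrow.mk (H.toFunctor.map g.hom))
          (fun y => Arrow.mk (α.toNatTrans.app y)) x).symm }

end

/-! ### Unit and multiplication on small categories. -/

lemma mul_act (T : Monad (Type u)) {X Y : Type u} (g : X → Y) (x : T.obj (T.obj X)) :
    T.μ.app Y (act T.toFunctor (act T.toFunctor g) x) = act T.toFunctor g (T.μ.app X x) :=
  natTrans_act T.μ g x

lemma act_mul_act (T : Monad (Type u)) {X Y Z : Type u} (g : Y → Z) (h : X → T.obj Y)
    (x : T.obj X) :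
    act T.toFunctor g (T.μ.app Y (act T.toFunctor h x)) =
      T.μ.app Z (act T.toFunctor (fun a => act T.toFunctor g (h a)) x) := by
  rw [← mul_act, act_act]

section

variable (T : Monad (Type u)) [PreservesLimitsOfShape WalkingCospan T.toFunctor]
  {𝒞 : Type u} [Category.{u} 𝒞]

variable (𝒞) in
/-- The unit of the monad `T` as a functor. -/
def unitFunctor : 𝒞 ⥤ Lift T.toFunctor 𝒞 where
  obj x := T.η.app 𝒞 x
  map f := Lift.Hom.mk (T.η.app (Arrow 𝒞) (Arrow.mk f)) (natTrans_act T.η _ _).symm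
    (natTrans_act T.η _ _).symm
  map_id x := lift_hom_ext (natTrans_act T.η (fun x : 𝒞 => Arrow.mk (𝟙 x)) x)
  map_comp {x y z} f g := by
    refine lift_hom_ext (Eq.trans ?_ (comp_val
      (T.η.app (ComposablePair 𝒞) ⟨f, g⟩) ?_ ?_).symm)
    · exact natTrans_act T.η (fun q : ComposablePair 𝒞 => Arrow.mk (q.fst ≫ q.snd)) ⟨f, g⟩
    · exact (natTrans_act T.η (fun q : ComposablePair 𝒞 => Arrow.mk q.fst) ⟨f, g⟩).symm
    · exact (natTrans_act T.η (fun q : ComposablePair 𝒞 => Arrow.mk q.snd) ⟨f, g⟩).symm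

variable (𝒞) in
/-- The multiplication of the monad `T` as a functor. -/
def mulFunctor : Lift T.toFunctor (Lift T.toFunctor 𝒞) ⥤ Lift T.toFunctor 𝒞 where
  obj x := T.μ.app 𝒞 x
  -- `f.val` lies in `T` of the arrows of the lifted category; `arrowEquiv` moves it into `T (T
  -- (Arrow 𝒞))`, where `μ` applies.
  map f := Lift.Hom.mk (T.μ.app (Arrow 𝒞) (act T.toFunctor (arrowEquiv T.toFunctor 𝒞) f.val))
    (by
      rw [act_mul_act]
      exact congrArg _ ((act_congr _ (fun g => g.hom.src) _).trans f.src))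
    (by
      rw [act_mul_act]
      exact congrArg _ ((act_congr _ (fun g => g.hom.tgt) _).trans f.tgt))
  map_id x := by
    apply lift_hom_ext
    refine Eq.trans ?_ (mul_act T (fun x : 𝒞 => Arrow.mk (𝟙 x)) x)
    exact congrArg _ (act_act _ _ _ _)
  map_comp {x y z} f g := by
    -- The witness applies `pair` under `T` to the outer pair, giving an element of `T (T
    -- (ComposablePair 𝒞))`, and flattens it by `μ`.
    refine lift_hom_ext (Eq.trans ?_ (comp_val (T.μ.app (ComposablePair 𝒞) (act T.toFunctor
      (fun q : ComposablePair (Lift T.toFunctor 𝒞) => pair q.fst q.snd) (pair f g))) ?_ ?_).symm)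
    · refine Eq.trans (congrArg (T.μ.app (Arrow 𝒞)) ?_) (act_mul_act T
        (fun q : ComposablePair 𝒞 => Arrow.mk (q.fst ≫ q.snd))
        (fun q : ComposablePair (Lift T.toFunctor 𝒞) => pair q.fst q.snd) (pair f g)).symm
      exact act_act _ _ _ _
    · refine (act_mul_act T _ _ _).trans (congrArg (T.μ.app (Arrow 𝒞)) ?_)
      refine (act_congr _ (fun q : ComposablePair (Lift T.toFunctor 𝒞) =>
        act_fst_pair q.fst q.snd) _).trans ?_
      exact (act_act T.toFunctor (arrowEquiv T.toFunctor 𝒞)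
        (fun q : ComposablePair (Lift T.toFunctor 𝒞) => Arrow.mk q.fst) _).symm.trans
        (congrArg _ (act_fst_pair f g))
    · refine (act_mul_act T _ _ _).trans (congrArg (T.μ.app (Arrow 𝒞)) ?_)
      refine (act_congr _ (fun q : ComposablePair (Lift T.toFunctor 𝒞) =>
        act_snd_pair q.fst q.snd) _).trans ?_
      exact (act_act T.toFunctor (arrowEquiv T.toFunctor 𝒞)
        (fun q : ComposablePair (Lift T.toFunctor 𝒞) => Arrow.mk q.snd) _).symm.trans
        (congrArg _ (act_snd_pair f g))

lemma mulFunctor_naturality {𝒟 : Type u} [Category.{u} 𝒟] (H : 𝒞 ⥤ 𝒟) :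
    mapFunctor T.toFunctor (mapFunctor T.toFunctor H) ⋙ mulFunctor T 𝒟 =
      mulFunctor T 𝒞 ⋙ mapFunctor T.toFunctor H :=
  functor_ext (fun x => mul_act T H.obj x) (fun f => by
    refine Eq.trans ?_ (mul_act T (fun g : Arrow 𝒞 => Arrow.mk (H.map g.hom)) _)
    refine congrArg (T.μ.app (Arrow 𝒟)) ?_
    exact (act_act T.toFunctor (arrowEquiv T.toFunctor 𝒟)
      (fun g : Arrow (Lift T.toFunctor 𝒞) => Arrow.mk ((mapFunctor T.toFunctor H).map g.hom))
      f.val).trans (act_act T.toFunctor (act T.toFunctor (fun g : Arrow 𝒞 => Arrow.mk (H.map g.hom)))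
      (arrowEquiv T.toFunctor 𝒞) f.val).symm)

lemma mulFunctor_assoc :
    mapFunctor T.toFunctor (mulFunctor T 𝒞) ⋙ mulFunctor T 𝒞 =
      mulFunctor T (Lift T.toFunctor 𝒞) ⋙ mulFunctor T 𝒞 :=
  functor_ext (fun x => types_congr_hom (T.assoc 𝒞) x) (fun f => by
    let e := arrowEquiv T.toFunctor 𝒞
    -- `v` is `f` with both layers of arrows unpacked; the two sides become the two sides of
    -- `T.assoc` at `v`.
    let v : T.obj (T.obj (T.obj (Arrow 𝒞))) := act T.toFunctor
      (fun g : Arrow (Lift T.toFunctor (Lift T.toFunctor 𝒞)) => act T.toFunctor e g.hom.val) f.val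
    have h₁ : T.μ.app _ (act T.toFunctor e (act T.toFunctor (fun g : Arrow _ =>
        Arrow.mk ((mulFunctor T 𝒞).map g.hom)) f.val)) =
          T.μ.app _ (act T.toFunctor (T.μ.app (Arrow 𝒞)) v) :=
      congrArg _ ((act_act _ _ _ _).trans (act_act T.toFunctor (T.μ.app (Arrow 𝒞))
        (fun g : Arrow (Lift T.toFunctor (Lift T.toFunctor 𝒞)) => act T.toFunctor e g.hom.val)
        f.val).symm)
    have h₂ : T.μ.app _ v =
        act T.toFunctor e (T.μ.app _ (act T.toFunctor (arrowEquiv T.toFunctor _) f.val)) :=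
      (congrArg _ (act_act _ _ _ _).symm).trans (mul_act T e _)
    exact h₁.trans ((types_congr_hom (T.assoc (Arrow 𝒞)) v).trans (congrArg _ h₂)))

/-- The 2-monad on small categories induced by a monad on sets that preserves pullbacks. -/
def twoMonad : TwoMonad Cat.{u, u} where
  toStrictPseudofunctor := twoFunctor T.toFunctor
  η :=
    { app 𝒞 := (unitFunctor T 𝒞).toCatHom
      naturality {𝒞 𝒟} H := Cat.ext (functor_ext
        (fun x => natTrans_act T.η H.toFunctor.obj x)
        (fun f => natTrans_act T.η (fun g : Arrow 𝒞 => Arrow.mk (H.toFunctor.map g.hom))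
          (Arrow.mk f)))
      naturality₂ {𝒞 𝒟 H K} α := by
        ext x
        refine lift_hom_ext ((comp_eqToHom_app_val _ _ x).trans
          (Eq.trans ?_ (eqToHom_comp_app_val _ _ x).symm))
        exact natTrans_act T.η (fun y : 𝒞 => Arrow.mk (α.toNatTrans.app y)) x }
  μ :=
    { app 𝒞 := (mulFunctor T 𝒞).toCatHom
      naturality H := Cat.ext (mulFunctor_naturality T H.toFunctor)
      naturality₂ {𝒞 𝒟 H K} α := by
        ext x
        refine lift_hom_ext ((comp_eqToHom_app_val _ _ x).trans
          (Eq.trans ?_ (eqToHom_comp_app_val _ _ x).symm))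
        refine Eq.trans ?_ (mul_act T (fun y : 𝒞 => Arrow.mk (α.toNatTrans.app y)) x)
        exact congrArg _ (act_act _ _ _ _) }
  left_unit 𝒞 := Cat.ext (functor_ext
    (fun x => types_congr_hom (T.left_unit 𝒞) x)
    (fun f => by
      refine Eq.trans ?_ (types_congr_hom (T.left_unit (Arrow 𝒞)) f.val)
      -- Naturality of `η` moves `arrowEquiv` inside the unit, leaving the unit law at `f.val`.
      exact congrArg _ (natTrans_act T.η (arrowEquiv T.toFunctor 𝒞) (Arrow.mk f)).symm))
  right_unit 𝒞 := Cat.ext (functor_ext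
    (fun x => types_congr_hom (T.right_unit 𝒞) x)
    (fun f => by
      refine Eq.trans ?_ (types_congr_hom (T.right_unit (Arrow 𝒞)) f.val)
      exact congrArg _ (act_act _ _ _ _)))
  assoc 𝒞 := Cat.ext (mulFunctor_assoc T)

/-- The 2-monad `twoMonad T` lifts `T`. -/
def setMonadLift : SetMonadLift T (twoMonad T) where
  ob _ := rfl
  ar 𝒞 := arrowEquiv T.toFunctor 𝒞
  src _ f := f.hom.src.symm
  tgt _ f := f.hom.tgt.symm
  ident _ _ := rfl
  comp _ {_ _ _} _ _ p hf hg := comp_val p hf.symm hg.symm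
  map₀ _ _ := rfl
  map₁ {_ _} _ {_ _} _ := rfl
  map₂ _ _ := rfl
  unit₀ _ _ := rfl
  unit₁ _ {_ _} _ := rfl
  -- The casts along `rfl` are identities, so `T` of a cast acts trivially.
  mul₀ 𝒞 x := (congrArg (T.μ.app 𝒞) (act_id T.toFunctor x)).symm
  mul₁ _ {_ _} _ := rfl

end

end SetLift

end SetLift

/-! ### The main theorem -/

theorem mainTheorem6 :
    (∀ (C : Type u) [Category.{v} C] [HasPullbacks C] (T : Monad C), T.IsCartesian →
      ∃ M : TwoMonad (InternalCat C), IsInternalLift T M) ∧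
    (∀ T : Monad (Type w), T.IsCartesian →
      ∃ N : TwoMonad Cat.{w, w}, Nonempty (SetMonadLift T N)) := by
  refine ⟨fun C _ _ T hT => ?_, fun T hT => ?_⟩
  · have := hT.preservesPullbacks
    exact ⟨InternalCat.mapTwoMonad T, InternalCat.isInternalLift_mapTwoMonad T⟩
  · have := hT.preservesPullbacks
    exact ⟨SetLift.twoMonad T, ⟨SetLift.setMonadLift T⟩⟩
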